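/- Let $n\ge 0$. An $n$-dimensional spherical building (not necessarily thick or irreducible) is a complete CAT(1) space $B$ together with a finite group $W$ of isometries of the unit sphere $\mathbb S^n$ (with its angular metric) generated by reflections, and a nonempty set of isometric embeddings $\iota:\mathbb S^n\to B$, called charts, which is closed under precomposition with elements of $W$, such that any two points of $B$ lie in the image of a common chart, and such that for any two charts $\iota_1,\iota_2$ the map $\iota_1^{-1}\circ\iota_2$ is, where it is defined, the restriction of an element of $W$. The images of the charts are called apartments. A subset $C\subset B$ is convex if for any $x,y\in C$ with $d(x,y)<\pi$ it contains the unique geodesic of $B$ between $x$ and $y$. It is spherical if it is isometric to a subset of the unit sphere $\mathbb S^k$ (with its angular metric) for some $k$. Let $B_1$ and $B_2$ be $n$-dimensional spherical buildings (possibly with different groups $W$), and let $f:B_1\to B_2$ be a surjective $1$-Lipschitz map. Let $C_1$ be a convex spherical subset of $B_1$ which is mapped by $f$ isometrically onto its image $C_2\subset B_2$. Let $A_2$ be an apartment in $B_2$ containing $C_2$. Then there exists an apartment $A_1$ in $B_1$ containing $C_1$ such that $f$ maps $A_1$ isometrically onto $A_2$. -/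

import Mathlib

open Set

/-- The unit sphere of dimension `n`, as the set of unit vectors of Euclidean `(n+1)`-space.
It is always used with its intrinsic (angular) distance `sphDist`, never with the chordal one. -/
abbrev Sph (n : ℕ) : Type := Metric.sphere (0 : EuclideanSpace ℝ (Fin (n + 1))) 1

/-- The intrinsic distance on the unit sphere: the angle between two unit vectors. -/
noncomputable def sphDist {n : ℕ} (u v : Sph n) : ℝ :=
  InnerProductGeometry.angle (u : EuclideanSpace ℝ (Fin (n + 1))) (v : EuclideanSpace ℝ (Fin (n + 1)))

/-- The action of a linear isometry on the unit sphere. -/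
noncomputable def sphAct {n : ℕ} (w : EuclideanSpace ℝ (Fin (n + 1)) ≃ₗᵢ[ℝ] EuclideanSpace ℝ (Fin (n + 1)))
    (u : Sph n) : Sph n :=
  ⟨w u, by simp⟩

/-- `c`, restricted to `[0, dist x y]`, is a (minimizing, unit speed) geodesic from `x` to `y`. -/
def IsGeodesicFromTo {X : Type*} [MetricSpace X] (c : ℝ → X) (x y : X) : Prop :=
  c 0 = x ∧ c (dist x y) = y ∧
    ∀ s ∈ Icc (0 : ℝ) (dist x y), ∀ t ∈ Icc (0 : ℝ) (dist x y), dist (c s) (c t) = |s - t|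

/-- `X` is a (complete) CAT(1) space: points at distance less than `π` are joined by geodesics, and
geodesic triangles `x y z` of perimeter less than `2π` are not thicker than their comparison
triangles `x' y' z'` in the unit 2-sphere. Here `p = c s` and `q = d t` are points on the two sides
issuing from the vertex `x`, and `p'`, `q'` are their comparison points. (Any two sides share a
vertex, and `x` is arbitrary.) -/
structure IsCAT1 (X : Type*) [MetricSpace X] : Prop where
  complete : CompleteSpace X
  exists_geodesic : ∀ x y : X, dist x y < Real.pi → ∃ c : ℝ → X, IsGeodesicFromTo c x y
  comparison : ∀ (x y z : X) (c d : ℝ → X),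
    dist x y + dist y z + dist z x < 2 * Real.pi →
    IsGeodesicFromTo c x y → IsGeodesicFromTo d x z →
    ∀ s ∈ Icc (0 : ℝ) (dist x y), ∀ t ∈ Icc (0 : ℝ) (dist x z),
    ∀ x' y' z' p' q' : Sph 2,
      sphDist x' y' = dist x y → sphDist y' z' = dist y z → sphDist x' z' = dist x z →
      sphDist x' p' = s → sphDist p' y' = dist x y - s →
      sphDist x' q' = t → sphDist q' z' = dist x z - t →
      dist (c s) (d t) ≤ sphDist p' q'

/-- The reflection in the hyperplane orthogonal to the vector `v`. -/
noncomputable def hyperplaneReflection {E : Type*} [NormedAddCommGroup E] [InnerProductSpace ℝ E]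
    (v : E) : E ≃ₗᵢ[ℝ] E :=
  (Submodule.orthogonal (Submodule.span ℝ {v})).reflection

/-- A finite group of isometries of the unit `n`-sphere generated by reflections, i.e. the pair
(sphere, `W`) is a spherical Coxeter complex. The group may be trivial. -/
def IsSphericalCoxeterGroup {n : ℕ}
    (W : Subgroup (EuclideanSpace ℝ (Fin (n + 1)) ≃ₗᵢ[ℝ] EuclideanSpace ℝ (Fin (n + 1)))) : Prop :=
  Finite W ∧ ∃ R : Set (EuclideanSpace ℝ (Fin (n + 1))), (∀ v ∈ R, v ≠ 0) ∧
    W = Subgroup.closure (hyperplaneReflection '' R)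

/-- An `n`-dimensional spherical building structure on the metric space `B`, in the sense of
Kleiner and Leeb: `B` is a CAT(1) space with an atlas of isometric embeddings (charts) of the unit
`n`-sphere, closed under precomposition with the Weyl group, such that any two points lie in a
common apartment and all coordinate changes are restrictions of elements of the Weyl group.
Neither thickness nor irreducibility is required. -/
structure SphericalBuilding (n : ℕ) (B : Type*) [MetricSpace B] where
  cat1 : IsCAT1 B
  weyl : Subgroup (EuclideanSpace ℝ (Fin (n + 1)) ≃ₗᵢ[ℝ] EuclideanSpace ℝ (Fin (n + 1)))
  coxeter : IsSphericalCoxeterGroup weyl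
  atlas : Set (Sph n → B)
  atlas_nonempty : atlas.Nonempty
  isometric : ∀ ι ∈ atlas, ∀ u v : Sph n, dist (ι u) (ι v) = sphDist u v
  precomp : ∀ ι ∈ atlas, ∀ w ∈ weyl, (fun u => ι (sphAct w u)) ∈ atlas
  plenty : ∀ x y : B, ∃ ι ∈ atlas, x ∈ range ι ∧ y ∈ range ι
  compatible : ∀ ι₁ ∈ atlas, ∀ ι₂ ∈ atlas, ∃ w ∈ weyl, ∀ u v : Sph n,
    ι₁ u = ι₂ v → u = sphAct w v

/-- An apartment is the image of a chart. -/
def SphericalBuilding.IsApartment {n : ℕ} {B : Type*} [MetricSpace B]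
    (𝔹 : SphericalBuilding n B) (A : Set B) : Prop :=
  ∃ ι ∈ 𝔹.atlas, range ι = A

/-- `C` is convex: it contains the geodesics between any two of its points at distance
less than `π`. -/
def IsPiConvex {B : Type*} [MetricSpace B] (C : Set B) : Prop :=
  ∀ x ∈ C, ∀ y ∈ C, dist x y < Real.pi → ∀ c : ℝ → B, IsGeodesicFromTo c x y →
    ∀ t ∈ Icc (0 : ℝ) (dist x y), c t ∈ C

/-- `C` is spherical: it is isometric to a subset of a unit sphere of some dimension. -/
def IsSphericalSet {B : Type*} [MetricSpace B] (C : Set B) : Prop :=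
  ∃ (k : ℕ) (g : C → Sph k), ∀ x y : C, sphDist (g x) (g y) = dist x y

/-- `f` maps the subset `A` isometrically onto the subset `A'`. -/
def MapsIsometricallyOnto {X Y : Type*} [MetricSpace X] [MetricSpace Y]
    (f : X → Y) (A : Set X) (A' : Set Y) : Prop :=
  (∀ x ∈ A, ∀ y ∈ A, dist (f x) (f y) = dist x y) ∧ f '' A = A'

/-! Say that a chart of `B₁` lifts an isometric embedding `κ` of the sphere if its composite with
`f` is `κ`. Two facts are used throughout. As `f` is short, preimages of antipodes of an apartment
are at distance at least `π`, so a chart joins them as antipodes. And a short map that agrees with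
an isometric embedding near `u` and at `-u` agrees with it everywhere, because short geodesics are
unique (`IsCAT1.eq_of_eventuallyEq`).

`exists_lift` produces one lift, after reparametrizing `A₂` by a linear isometry. In a chart through
preimages of `κ u` and `κ (-u)`, with `u` regular, `f` carries half circles to geodesics that cannot
leave the apartment, so distances from the centre are preserved. Moving the centre within a small
regular neighbourhood, where all these charts agree, makes the map isometric there, hence linear.

`exists_lift_through` changes a lift so that it passes through a given preimage `p₁` of `κ p`,
keeping every `ι z` that is no farther from `p₁` than `z` is from `p`. Points of `C₁` are as far
apart as their images, so finitely many of them can be absorbed one at a time. Finitely many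
suffice: the sphere splits into finitely many cells such that charts agreeing at one point of a cell
agree on all of it (`chart_eq_of_signVector_eq`). -/

open Set Filter Topology InnerProductGeometry

/-! ### The angular metric on the sphere and its short and isometric maps. -/

section Sphere

variable {n : ℕ}

theorem Sph.coe_ne_zero (u : Sph n) : (u : EuclideanSpace ℝ (Fin (n + 1))) ≠ 0 :=
  ne_zero_of_mem_unit_sphere u

theorem sphDist_self (u : Sph n) : sphDist u u = 0 := angle_self u.coe_ne_zero

theorem sphDist_comm (u v : Sph n) : sphDist u v = sphDist v u := angle_comm _ _

theorem sphDist_nonneg (u v : Sph n) : 0 ≤ sphDist u v := angle_nonneg _ _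

theorem sphDist_le_pi (u v : Sph n) : sphDist u v ≤ Real.pi := angle_le_pi _ _

theorem sphDist_neg_right (u v : Sph n) : sphDist u (-v) = Real.pi - sphDist u v :=
  angle_neg_right _ _

theorem sphDist_neg_left (u v : Sph n) : sphDist (-u) v = Real.pi - sphDist u v :=
  angle_neg_left _ _

theorem eq_of_sphDist_eq_zero {u v : Sph n} (h : sphDist u v = 0) : u = v :=
  Subtype.ext (eq_of_angle_eq_zero_of_norm_eq h (by simp))

theorem eq_neg_of_sphDist_eq_pi {u v : Sph n} (h : sphDist u v = Real.pi) : v = -u := by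
  refine (eq_of_sphDist_eq_zero ?_).symm
  rw [sphDist_neg_left, h, sub_self]

theorem sphDist_sphAct (w : EuclideanSpace ℝ (Fin (n + 1)) ≃ₗᵢ[ℝ] EuclideanSpace ℝ (Fin (n + 1)))
    (u v : Sph n) : sphDist (sphAct w u) (sphAct w v) = sphDist u v :=
  w.toLinearIsometry.angle_map _ _

theorem continuous_sphDist : Continuous fun p : Sph n × Sph n => sphDist p.1 p.2 := by
  rw [continuous_iff_continuousAt]
  intro p
  have h := continuousAt_angle (x := ((p.1 : EuclideanSpace ℝ (Fin (n + 1))),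
    (p.2 : EuclideanSpace ℝ (Fin (n + 1))))) p.1.coe_ne_zero p.2.coe_ne_zero
  exact ContinuousAt.comp (f := fun q : Sph n × Sph n => ((q.1 : EuclideanSpace ℝ (Fin (n + 1))),
    (q.2 : EuclideanSpace ℝ (Fin (n + 1))))) h (by fun_prop)

theorem continuous_sphAct
    (w : EuclideanSpace ℝ (Fin (n + 1)) ≃ₗᵢ[ℝ] EuclideanSpace ℝ (Fin (n + 1))) :
    Continuous (sphAct w) :=
  Continuous.subtype_mk (w.continuous.comp continuous_subtype_val) _

theorem sphAct_one (u : Sph n) : sphAct 1 u = u := rfl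

theorem sphAct_mul
    (w w' : EuclideanSpace ℝ (Fin (n + 1)) ≃ₗᵢ[ℝ] EuclideanSpace ℝ (Fin (n + 1))) (u : Sph n) :
    sphAct (w * w') u = sphAct w (sphAct w' u) := rfl

theorem sphAct_neg
    (w : EuclideanSpace ℝ (Fin (n + 1)) ≃ₗᵢ[ℝ] EuclideanSpace ℝ (Fin (n + 1))) (u : Sph n) :
    sphAct w (-u) = -sphAct w u := Subtype.ext (by simp [sphAct])

/-- The point of the unit sphere in the direction of a nonzero vector. -/
noncomputable def toSph (x : EuclideanSpace ℝ (Fin (n + 1))) : Sph n :=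
  if h : x = 0 then ⟨EuclideanSpace.single 0 1, by simp⟩
  else ⟨‖x‖⁻¹ • x, by simp [norm_smul, h]⟩

theorem coe_toSph {x : EuclideanSpace ℝ (Fin (n + 1))} (hx : x ≠ 0) :
    (toSph x : EuclideanSpace ℝ (Fin (n + 1))) = ‖x‖⁻¹ • x := by
  simp [toSph, hx]

theorem toSph_coe (u : Sph n) : toSph (u : EuclideanSpace ℝ (Fin (n + 1))) = u :=
  Subtype.ext (by rw [coe_toSph u.coe_ne_zero]; simp)

theorem toSph_smul {x : EuclideanSpace ℝ (Fin (n + 1))} (hx : x ≠ 0) {c : ℝ} (hc : 0 < c) :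
    toSph (c • x) = toSph x := by
  apply Subtype.ext
  rw [coe_toSph hx, coe_toSph (smul_ne_zero hc.ne' hx), norm_smul, smul_smul,
    Real.norm_of_nonneg hc.le]
  congr 1
  field_simp

theorem sphDist_toSph {x y : EuclideanSpace ℝ (Fin (n + 1))} (hx : x ≠ 0) (hy : y ≠ 0) :
    sphDist (toSph x) (toSph y) = angle x y := by
  rw [sphDist, coe_toSph hx, coe_toSph hy, angle_smul_left_of_pos _ _ (by positivity),
    angle_smul_right_of_pos _ _ (by positivity)]

theorem sphDist_toSph_left {x : EuclideanSpace ℝ (Fin (n + 1))} (hx : x ≠ 0) (u : Sph n) :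
    sphDist (toSph x) u = angle x u := by
  simpa only [toSph_coe] using sphDist_toSph hx u.coe_ne_zero

theorem sphDist_toSph_right {x : EuclideanSpace ℝ (Fin (n + 1))} (hx : x ≠ 0) (u : Sph n) :
    sphDist u (toSph x) = angle (u : EuclideanSpace ℝ (Fin (n + 1))) x := by
  simpa only [toSph_coe] using sphDist_toSph u.coe_ne_zero hx

theorem continuousAt_toSph {x : EuclideanSpace ℝ (Fin (n + 1))} (hx : x ≠ 0) :
    ContinuousAt (toSph : _ → Sph n) x := by
  rw [Topology.IsInducing.subtypeVal.continuousAt_iff]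
  have h : ContinuousAt (fun y : EuclideanSpace ℝ (Fin (n + 1)) => ‖y‖⁻¹ • y) x :=
    (continuousAt_id.norm.inv₀ (by simpa using hx)).smul continuousAt_id
  refine h.congr ?_
  filter_upwards [isOpen_ne.mem_nhds hx] with y hy
  exact (coe_toSph hy).symm

theorem sphAct_toSph (w : EuclideanSpace ℝ (Fin (n + 1)) ≃ₗᵢ[ℝ] EuclideanSpace ℝ (Fin (n + 1)))
    {x : EuclideanSpace ℝ (Fin (n + 1))} (hx : x ≠ 0) : sphAct w (toSph x) = toSph (w x) := by
  apply Subtype.ext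
  have : w x ≠ 0 := by simpa using hx
  rw [coe_toSph this, sphAct]
  simp [coe_toSph hx]

theorem angle_add_angle_of_nonneg {E : Type*} [NormedAddCommGroup E] [InnerProductSpace ℝ E]
    {x y : E} {a b : ℝ} (ha : 0 ≤ a) (hb : 0 ≤ b) (h : a • x + b • y ≠ 0) :
    angle x (a • x + b • y) + angle (a • x + b • y) y = angle x y := by
  symm
  apply angle_eq_angle_add_add_angle_add_of_mem_span h
  rw [Submodule.mem_span_pair]
  exact ⟨⟨a, ha⟩, ⟨b, hb⟩, rfl⟩

/-- A map from the sphere that preserves the angular distance. -/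
def SphIsometric {B : Type*} [MetricSpace B] (φ : Sph n → B) : Prop :=
  ∀ u v : Sph n, dist (φ u) (φ v) = sphDist u v

theorem SphIsometric.injective {B : Type*} [MetricSpace B] {φ : Sph n → B} (h : SphIsometric φ) :
    Function.Injective φ := fun u v huv => by
  apply eq_of_sphDist_eq_zero
  rw [← h, huv, dist_self]

/-- A map from the sphere that does not increase the angular distance. -/
def SphShort {B : Type*} [MetricSpace B] (φ : Sph n → B) : Prop :=
  ∀ u v : Sph n, dist (φ u) (φ v) ≤ sphDist u v

theorem SphIsometric.short {B : Type*} [MetricSpace B] {φ : Sph n → B} (h : SphIsometric φ) :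
    SphShort φ := fun u v => (h u v).le

theorem SphShort.comp {B B' : Type*} [MetricSpace B] [MetricSpace B'] {φ : Sph n → B}
    (h : SphShort φ) {f : B → B'} (hf : LipschitzWith 1 f) : SphShort (n := n) fun u => f (φ u) := by
  intro u v
  have h1 := hf.dist_le_mul (φ u) (φ v)
  rw [NNReal.coe_one, one_mul] at h1
  exact h1.trans (h u v)

theorem tendsto_sphDist_self (u : Sph n) : Tendsto (fun v : Sph n => sphDist v u) (𝓝 u) (𝓝 0) := by
  have h : Continuous fun v : Sph n => sphDist v u :=
    Continuous.comp (g := fun p : Sph n × Sph n => sphDist p.1 p.2) (f := fun v => (v, u))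
      continuous_sphDist (by fun_prop)
  have h0 := h.tendsto u
  rwa [sphDist_self] at h0

theorem SphShort.continuous {B : Type*} [MetricSpace B] {φ : Sph n → B} (h : SphShort φ) :
    Continuous φ :=
  continuous_iff_continuousAt.2 fun u => tendsto_iff_dist_tendsto_zero.2 <|
    squeeze_zero (fun _ => dist_nonneg) (fun v => h v u) (tendsto_sphDist_self u)

theorem SphIsometric.comp_sphAct {B : Type*} [MetricSpace B] {φ : Sph n → B} (h : SphIsometric φ)
    (w : EuclideanSpace ℝ (Fin (n + 1)) ≃ₗᵢ[ℝ] EuclideanSpace ℝ (Fin (n + 1))) :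
    SphIsometric fun u => φ (sphAct w u) :=
  fun u v => (h _ _).trans (sphDist_sphAct w u v)

end Sphere

/-! ### Uniqueness of short geodesics and rigidity of maps from the sphere. -/

section CAT1

/-- Supplies the degenerate comparison triangle for `IsCAT1.eq_of_between`. -/
theorem exists_arc_Sph_two : ∃ P : ℝ → Sph 2, ∀ s t, |s - t| ≤ Real.pi →
    sphDist (P s) (P t) = |s - t| := by
  have hn : ∀ t : ℝ, ‖(!₂[Real.cos t, Real.sin t, 0] : EuclideanSpace ℝ (Fin 3))‖ = 1 := by
    intro t
    simp [EuclideanSpace.norm_eq, Fin.sum_univ_three]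
  refine ⟨fun t => ⟨!₂[Real.cos t, Real.sin t, 0], by simpa using hn t⟩, fun s t h => ?_⟩
  have : inner ℝ (!₂[Real.cos s, Real.sin s, 0] : EuclideanSpace ℝ (Fin 3))
      !₂[Real.cos t, Real.sin t, 0] = Real.cos |s - t| := by
    rw [Real.cos_abs, Real.cos_sub]
    simp [PiLp.inner_apply, Fin.sum_univ_three, mul_comm]
  rw [sphDist, angle, hn, hn, this]
  simpa using Real.arccos_cos (abs_nonneg _) h

variable {X : Type*} [MetricSpace X]

/-- Concatenating geodesics through `z` loses no length, since the triangle inequality at `z` is an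
equality. -/
theorem IsCAT1.exists_geodesic_through (hX : IsCAT1 X) {x y z : X} (hxy : dist x y < Real.pi)
    (h : dist x z + dist z y = dist x y) :
    ∃ c : ℝ → X, IsGeodesicFromTo c x y ∧ c (dist x z) = z := by
  have h1 := dist_nonneg (x := x) (y := z)
  have h2 := dist_nonneg (x := z) (y := y)
  obtain ⟨c, c0, c1, hc⟩ := hX.exists_geodesic x z (by linarith)
  obtain ⟨d, d0, d1, hd⟩ := hX.exists_geodesic z y (by linarith)
  let e : ℝ → X := fun t => if t ≤ dist x z then c t else d (t - dist x z)
  have e1 : ∀ t, t ≤ dist x z → e t = c t := fun t ht => if_pos ht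
  have e2 : ∀ t, dist x z ≤ t → e t = d (t - dist x z) := by
    intro t ht
    rcases ht.eq_or_lt with rfl | ht
    · rw [e1 _ le_rfl, c1, sub_self, d0]
    · exact if_neg (not_le.2 ht)
  have key : ∀ s ∈ Icc (0 : ℝ) (dist x y), ∀ t ∈ Icc (0 : ℝ) (dist x y), s ≤ t →
      dist (e s) (e t) = |s - t| := by
    intro s hs t ht hst
    rcases le_total t (dist x z) with h3 | h3
    · rw [e1 _ h3, e1 _ (hst.trans h3)]
      exact hc s ⟨hs.1, hst.trans h3⟩ t ⟨ht.1, h3⟩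
    rcases le_total (dist x z) s with h4 | h4
    · rw [e2 _ h4, e2 _ h3, hd _ ⟨by linarith, by linarith [hs.2]⟩ _
        ⟨by linarith, by linarith [ht.2]⟩]
      congr 1; ring
    · rw [e1 _ h4, e2 _ h3, abs_of_nonpos (by linarith)]
      have a1 := hc s ⟨hs.1, h4⟩ _ ⟨h1, le_rfl⟩
      have a2 := hd 0 ⟨le_rfl, h2⟩ (t - dist x z) ⟨by linarith, by linarith [ht.2]⟩
      have a3 := hc 0 ⟨le_rfl, h1⟩ s ⟨hs.1, h4⟩
      have a4 := hd (t - dist x z) ⟨by linarith, by linarith [ht.2]⟩ _ ⟨h2, le_rfl⟩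
      rw [c1, abs_of_nonpos (by linarith)] at a1
      rw [d0, abs_of_nonpos (by linarith)] at a2
      rw [c0, abs_of_nonpos (by linarith [hs.1])] at a3
      rw [d1, abs_of_nonpos (by linarith [ht.2])] at a4
      -- The path through `z` bounds the distance from above; the total length from `x` to `y`
      -- bounds it from below.
      have a5 := dist_triangle (c s) z (d (t - dist x z))
      have a6 := dist_triangle4 x (c s) (d (t - dist x z)) y
      linarith
  refine ⟨e, ⟨?_, ?_, ?_⟩, ?_⟩
  · rw [e1 _ h1, c0]
  · rw [e2 _ (by linarith), ← h, add_sub_cancel_left, d1]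
  · intro s hs t ht
    rcases le_total s t with hst | hst
    · exact key s hs t ht hst
    · rw [dist_comm, abs_sub_comm]
      exact key t ht s hs hst
  · rw [e1 _ le_rfl, c1]

/-- A point on a short geodesic of a CAT(1) space is determined by its distances to the
endpoints. -/
theorem IsCAT1.eq_of_between (hX : IsCAT1 X) {x y z z' : X} {a b : ℝ} (hxy : dist x y < Real.pi)
    (hab : a + b ≤ dist x y) (h1 : dist x z ≤ a) (h2 : dist z y ≤ b) (h3 : dist x z' ≤ a)
    (h4 : dist z' y ≤ b) : z = z' := by
  have t1 := dist_triangle x z y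
  have t2 := dist_triangle x z' y
  have e1 : dist x z = a := by linarith
  have e2 : dist x z' = a := by linarith
  obtain ⟨c, hc, hcz⟩ := hX.exists_geodesic_through (z := z) hxy (by linarith)
  obtain ⟨d, hd, hdz⟩ := hX.exists_geodesic_through (z := z') hxy (by linarith)
  rw [e1] at hcz
  rw [e2] at hdz
  have ha : 0 ≤ a := e1 ▸ dist_nonneg
  have hb : a ≤ dist x y := by
    have := dist_nonneg (x := z) (y := y)
    linarith
  obtain ⟨P, hP⟩ := exists_arc_Sph_two
  have hP' : ∀ s t, 0 ≤ s → s ≤ t → t ≤ dist x y → sphDist (P s) (P t) = t - s := by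
    intro s t hs hst ht
    rw [hP, abs_of_nonpos (by linarith), neg_sub]
    rw [abs_le]
    constructor <;> linarith
  have hL := dist_nonneg (x := x) (y := y)
  -- Comparison for the degenerate triangle `x y y`, whose two sides are the geodesics through `z`
  -- and `z'`.
  have key := hX.comparison x y y c d (by rw [dist_self, dist_comm y x]; linarith) hc hd a ⟨ha, hb⟩
    a ⟨ha, hb⟩ (P 0) (P (dist x y)) (P (dist x y)) (P a) (P a)
    (by rw [hP' _ _ le_rfl hL le_rfl, sub_zero]) (by rw [sphDist_self, dist_self])
    (by rw [hP' _ _ le_rfl hL le_rfl, sub_zero])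
    (by rw [hP' _ _ le_rfl ha hb, sub_zero]) (hP' _ _ ha hb le_rfl)
    (by rw [hP' _ _ le_rfl ha hb, sub_zero]) (hP' _ _ ha hb le_rfl)
  rw [sphDist_self, hcz, hdz] at key
  exact dist_le_zero.1 key

variable {n : ℕ}

/-- Two maps from the sphere that agree near `u` also agree at each `v` whose image under the
second has the expected distance to the antipode of the image of `u`. -/
theorem IsCAT1.eq_of_eventuallyEq (hX : IsCAT1 X) {φ ψ : Sph n → X} (hφ : SphIsometric φ)
    (hψ : SphShort ψ) {u v : Sph n} (h : ∀ᶠ z in 𝓝 u, φ z = ψ z)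
    (hv : dist (ψ v) (φ (-u)) ≤ sphDist v (-u)) : ψ v = φ v := by
  rcases eq_or_ne v u with rfl | hvu
  · exact h.self_of_nhds.symm
  rcases eq_or_ne v (-u) with rfl | hvu'
  · rw [sphDist_self] at hv
    exact dist_le_zero.1 hv
  have hnz : ∀ t : ℝ, 0 ≤ t → (u + t • v : EuclideanSpace ℝ (Fin (n + 1))) ≠ 0 := by
    intro t ht h0
    have h1 : (u : EuclideanSpace ℝ (Fin (n + 1))) = -(t • v) := eq_neg_of_add_eq_zero_left h0
    have h2 : ‖(u : EuclideanSpace ℝ (Fin (n + 1)))‖ = ‖t • (v : EuclideanSpace ℝ (Fin (n + 1)))‖ := by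
      rw [h1, norm_neg]
    rw [norm_smul, norm_eq_of_mem_sphere, norm_eq_of_mem_sphere, mul_one, Real.norm_of_nonneg ht] at h2
    rw [← h2, one_smul] at h1
    exact hvu' (Subtype.ext (by rw [coe_neg_sphere, h1, neg_neg]))
  have hc : Tendsto (fun t : ℝ => toSph (u + t • v : EuclideanSpace ℝ (Fin (n + 1)))) (𝓝[>] 0)
      (𝓝 u) := by
    have h1 : ContinuousAt (fun t : ℝ => toSph (u + t • v : EuclideanSpace ℝ (Fin (n + 1)))) 0 :=
      ContinuousAt.comp (f := fun t : ℝ => (u + t • v : EuclideanSpace ℝ (Fin (n + 1))))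
        (continuousAt_toSph (hnz 0 le_rfl)) (by fun_prop)
    have h2 := h1.tendsto
    simp only [zero_smul, add_zero, toSph_coe] at h2
    exact h2.mono_left nhdsWithin_le_nhds
  obtain ⟨t, ht, ht0⟩ := ((hc.eventually h).and self_mem_nhdsWithin).exists
  have ht0 : 0 < t := ht0
  have nz := hnz t ht0.le
  set m := toSph (u + t • v : EuclideanSpace ℝ (Fin (n + 1))) with hm
  have hadd : sphDist u m + sphDist m v = sphDist u v := by
    have := angle_add_angle_of_nonneg (x := (u : EuclideanSpace ℝ (Fin (n + 1))))
      (y := (v : EuclideanSpace ℝ (Fin (n + 1)))) zero_le_one ht0.le (by simpa using nz)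
    rw [one_smul] at this
    rw [hm, sphDist_toSph_right nz, sphDist_toSph_left nz, this, sphDist]
  -- Strictness puts `m` at distance less than `π` from `-u`, where geodesics are unique and pass
  -- through the image of `v`.
  have hmu : 0 < sphDist u m := by
    refine lt_of_le_of_ne (sphDist_nonneg _ _) fun h0 => ?_
    have h1 := eq_of_sphDist_eq_zero h0.symm
    have h2 : sphDist u m = 0 := h0.symm
    rw [hm, sphDist_toSph_right nz, angle_eq_zero_iff] at h2
    obtain ⟨-, r, hr, hr'⟩ := h2
    have h3 : t • (v : EuclideanSpace ℝ (Fin (n + 1))) = (r - 1) • (u : EuclideanSpace ℝ (Fin (n + 1))) := by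
      rw [sub_smul, one_smul, ← hr', add_sub_cancel_left]
    have h4 : (v : EuclideanSpace ℝ (Fin (n + 1))) = (t⁻¹ * (r - 1)) • (u : EuclideanSpace ℝ (Fin (n + 1))) := by
      rw [mul_smul, ← h3, smul_smul, inv_mul_cancel₀ ht0.ne', one_smul]
    have h5 : |t⁻¹ * (r - 1)| = 1 := by
      have := congrArg norm h4
      rw [norm_smul, norm_eq_of_mem_sphere, norm_eq_of_mem_sphere, mul_one] at this
      exact this.symm
    rcases eq_or_eq_neg_of_abs_eq h5 with h6 | h6
    · rw [h6, one_smul] at h4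
      exact hvu (Subtype.ext h4)
    · rw [h6, neg_one_smul] at h4
      exact hvu' (Subtype.ext h4)
  have e1 : sphDist v (-u) = Real.pi - sphDist u v := by rw [sphDist_neg_right, sphDist_comm]
  have e2 : sphDist m (-u) = Real.pi - sphDist u m := by rw [sphDist_neg_right, sphDist_comm]
  refine hX.eq_of_between (x := φ m) (y := φ (-u)) (a := sphDist m v) (b := sphDist v (-u))
    ?_ ?_ ?_ hv (hφ _ _).le (hφ _ _).le
  · rw [hφ, e2]; linarith
  · rw [hφ, e2, e1]; linarith
  · rw [ht]; exact hψ _ _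

/-- The direction of `x + y` lies on the arc from `x` to `y`, so a short map with the right values
at the ends has no freedom there. -/
theorem IsCAT1.eq_toSph_add (hX : IsCAT1 X) {φ ψ : Sph n → X} (hφ : SphIsometric φ)
    (hψ : SphShort ψ) {x y : EuclideanSpace ℝ (Fin (n + 1))} (hx : x ≠ 0) (hy : y ≠ 0)
    (hxy : angle x y < Real.pi) (h1 : φ (toSph x) = ψ (toSph x)) (h2 : φ (toSph y) = ψ (toSph y)) :
    φ (toSph (x + y)) = ψ (toSph (x + y)) := by
  have h0 : x + y ≠ 0 := by
    intro h
    rw [eq_neg_of_add_eq_zero_right h, angle_self_neg_of_nonzero hx] at hxy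
    exact hxy.false
  have hadd := angle_add_angle_of_nonneg (x := x) (y := y) zero_le_one zero_le_one
    (by simpa using h0)
  rw [one_smul, one_smul, ← sphDist_toSph hx h0, ← sphDist_toSph h0 hy, ← sphDist_toSph hx hy]
    at hadd
  rw [← sphDist_toSph hx hy] at hxy
  refine hX.eq_of_between (x := φ (toSph x)) (y := φ (toSph y)) (by rwa [hφ]) (by rw [hφ, hadd])
    (hφ _ _).le (hφ _ _).le ?_ ?_
  · rw [h1]; exact hψ _ _
  · rw [h2]; exact hψ _ _

end CAT1

/-! ### Regular points of a finite group acting on the sphere. -/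

section Regular

variable {n : ℕ}
  {W : Subgroup (EuclideanSpace ℝ (Fin (n + 1)) ≃ₗᵢ[ℝ] EuclideanSpace ℝ (Fin (n + 1)))}

/-- A point of the sphere is regular if its stabilizer is trivial. -/
def IsRegularPoint
    (W : Subgroup (EuclideanSpace ℝ (Fin (n + 1)) ≃ₗᵢ[ℝ] EuclideanSpace ℝ (Fin (n + 1))))
    (u : Sph n) : Prop :=
  ∀ w ∈ W, sphAct w u = u → w = 1

theorem sphAct_toSph_eq_iff
    {w : EuclideanSpace ℝ (Fin (n + 1)) ≃ₗᵢ[ℝ] EuclideanSpace ℝ (Fin (n + 1))}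
    {x : EuclideanSpace ℝ (Fin (n + 1))} (hx : x ≠ 0) :
    sphAct w (toSph x) = toSph x ↔ w x = x := by
  rw [sphAct_toSph w hx]
  refine ⟨fun h => ?_, fun h => by rw [h]⟩
  have h1 := congrArg (Subtype.val : Sph n → _) h
  rw [coe_toSph hx, coe_toSph (by simpa using hx), w.norm_map] at h1
  exact smul_right_injective _ (inv_ne_zero (norm_ne_zero_iff.2 hx)) h1

/-- An element moving `u` displaces all nearby points by an amount bounded below, while the distance
between two points near `u` tends to zero. Finiteness makes the neighbourhood uniform in `w`. -/
theorem eventually_fixes_of_displacement_le (hW : Finite W) (u : Sph n) :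
    ∀ᶠ p in 𝓝 u ×ˢ 𝓝 u, ∀ w ∈ (W : Set _),
      sphDist p.2 (sphAct w p.2) ≤ 2 * sphDist p.1 p.2 → sphAct w u = u := by
  have hfin : (W : Set (EuclideanSpace ℝ (Fin (n + 1)) ≃ₗᵢ[ℝ] EuclideanSpace ℝ (Fin (n + 1)))).Finite :=
    hW
  rw [eventually_all_finite hfin, ← nhds_prod_eq]
  intro w _
  by_cases hw : sphAct w u = u
  · exact Eventually.of_forall fun _ _ => hw
  have c1 : Continuous fun p : Sph n × Sph n => sphDist p.2 (sphAct w p.2) :=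
    Continuous.comp (g := fun p : Sph n × Sph n => sphDist p.1 p.2)
      (f := fun p : Sph n × Sph n => (p.2, sphAct w p.2)) continuous_sphDist
      (continuous_snd.prodMk ((continuous_sphAct w).comp continuous_snd))
  have c2 : Continuous fun p : Sph n × Sph n => 2 * sphDist p.1 p.2 :=
    continuous_const.mul continuous_sphDist
  have h0 : 2 * sphDist u u < sphDist u (sphAct w u) := by
    rw [sphDist_self, mul_zero]
    exact lt_of_le_of_ne (sphDist_nonneg _ _) fun h => hw (eq_of_sphDist_eq_zero h.symm).symm
  have h1 : ∀ᶠ p in 𝓝 (u, u), 2 * sphDist p.1 p.2 < sphDist p.2 (sphAct w p.2) :=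
    (isOpen_lt c2 c1).mem_nhds h0
  filter_upwards [h1] with p hp hp'
  exact absurd hp (not_lt.2 hp')

theorem IsRegularPoint.eventually (hW : Finite W) {u : Sph n} (hu : IsRegularPoint W u) :
    ∀ᶠ v in 𝓝 u, IsRegularPoint W v := by
  have h := (tendsto_id.prodMk tendsto_id).eventually (eventually_fixes_of_displacement_le hW u)
  filter_upwards [h] with v hv w hw hwv
  refine hu w hw (hv w hw ?_)
  simp only [id]
  rw [hwv, sphDist_self, mul_zero]

/-- A real vector space is not a finite union of proper subspaces, here the fixed spaces of the
nontrivial elements. -/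
theorem exists_regular_vector (hW : Finite W) :
    ∃ e : EuclideanSpace ℝ (Fin (n + 1)), ∀ w ∈ W, w e = e → w = 1 := by
  classical
  let F : W → Submodule ℝ (EuclideanSpace ℝ (Fin (n + 1))) := fun w =>
    LinearMap.ker (w.1.toLinearEquiv.toLinearMap - LinearMap.id)
  have hF : ∀ (w : W) x, x ∈ F w ↔ w.1 x = x := by
    intro w x
    simp [F, sub_eq_zero]
  by_contra! hcon
  have hcov : ⋃ w : {w : W // w ≠ 1}, (F w.1 : Set (EuclideanSpace ℝ (Fin (n + 1)))) = univ := by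
    refine eq_univ_of_forall fun x => ?_
    obtain ⟨w, hw, hwx, hw1⟩ := hcon x
    exact mem_iUnion.2 ⟨⟨⟨w, hw⟩, fun h => hw1 (congrArg Subtype.val h)⟩, (hF _ _).2 hwx⟩
  obtain ⟨w, hw⟩ := Subspace.exists_eq_top_of_iUnion_eq_univ hcov
  refine w.2 (Subtype.ext (LinearIsometryEquiv.ext fun x => ?_))
  have : x ∈ F w.1 := hw ▸ Submodule.mem_top
  exact (hF _ _).1 this

theorem eventually_add_smul_ne_zero (q : Sph n) (e : EuclideanSpace ℝ (Fin (n + 1))) :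
    ∀ᶠ t : ℝ in 𝓝 0, (q + t • e : EuclideanSpace ℝ (Fin (n + 1))) ≠ 0 := by
  have h : Continuous fun t : ℝ => (q + t • e : EuclideanSpace ℝ (Fin (n + 1))) := by fun_prop
  exact (isOpen_ne.preimage h).mem_nhds (by simpa using q.coe_ne_zero)

/-- Elements moving `q` still move nearby points; an element fixing both `q` and `q + t • e` with `t
≠ 0` fixes `e`. -/
theorem eventually_isRegularPoint_add_smul (hW : Finite W) (q : Sph n)
    {e : EuclideanSpace ℝ (Fin (n + 1))} (he : ∀ w ∈ W, w e = e → w = 1) :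
    ∀ᶠ t : ℝ in 𝓝[≠] 0, IsRegularPoint W (toSph (q + t • e)) := by
  have hfin : (W : Set (EuclideanSpace ℝ (Fin (n + 1)) ≃ₗᵢ[ℝ] EuclideanSpace ℝ (Fin (n + 1)))).Finite :=
    hW
  have key : ∀ᶠ t : ℝ in 𝓝[≠] 0,
      ∀ w ∈ (W : Set (EuclideanSpace ℝ (Fin (n + 1)) ≃ₗᵢ[ℝ] EuclideanSpace ℝ (Fin (n + 1)))),
      w (q + t • e : EuclideanSpace ℝ (Fin (n + 1))) = q + t • e → w = 1 := by
    rw [eventually_all_finite hfin]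
    intro w hw
    by_cases hq : w (q : EuclideanSpace ℝ (Fin (n + 1))) = q
    · filter_upwards [self_mem_nhdsWithin] with t ht h
      rw [map_add, hq, map_smul] at h
      exact he w hw (smul_right_injective _ ht (add_left_cancel h))
    · have c1 : Continuous fun t : ℝ => w (q + t • e : EuclideanSpace ℝ (Fin (n + 1))) :=
        w.continuous.comp (by fun_prop)
      have c2 : Continuous fun t : ℝ => (q + t • e : EuclideanSpace ℝ (Fin (n + 1))) := by fun_prop
      have h1 : ∀ᶠ t : ℝ in 𝓝 0, w (q + t • e : EuclideanSpace ℝ (Fin (n + 1))) ≠ q + t • e :=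
        (isOpen_ne_fun c1 c2).mem_nhds (by simpa using hq)
      filter_upwards [nhdsWithin_le_nhds h1] with t ht h
      exact absurd h ht
  filter_upwards [key, nhdsWithin_le_nhds (eventually_add_smul_ne_zero q e)] with t ht hz w hw h
  exact ht w hw ((sphAct_toSph_eq_iff hz).1 h)

theorem tendsto_toSph_add_smul (q : Sph n) (e : EuclideanSpace ℝ (Fin (n + 1))) :
    Tendsto (fun t : ℝ => toSph (q + t • e : EuclideanSpace ℝ (Fin (n + 1)))) (𝓝 0) (𝓝 q) := by
  have h1 : ContinuousAt (fun t : ℝ => toSph (q + t • e : EuclideanSpace ℝ (Fin (n + 1)))) 0 :=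
    ContinuousAt.comp (f := fun t : ℝ => (q + t • e : EuclideanSpace ℝ (Fin (n + 1))))
      (continuousAt_toSph (by simpa using q.coe_ne_zero)) (by fun_prop)
  have h2 := h1.tendsto
  simpa only [zero_smul, add_zero, toSph_coe] using h2

theorem frequently_isRegularPoint (hW : Finite W) (q : Sph n) :
    ∃ᶠ u in 𝓝 q, IsRegularPoint W u := by
  obtain ⟨e, he⟩ := exists_regular_vector hW
  exact ((tendsto_toSph_add_smul q e).mono_left nhdsWithin_le_nhds).frequently
    (eventually_isRegularPoint_add_smul hW q he).frequently

end Regular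

/-! ### Propagating the agreement of two charts. -/

namespace SphericalBuilding

variable {n : ℕ} {B : Type*} [MetricSpace B] (𝔹 : SphericalBuilding n B) {ι ι' : Sph n → B}

theorem finite_weyl : Finite 𝔹.weyl := 𝔹.coxeter.1

theorem sphIsometric (hι : ι ∈ 𝔹.atlas) : SphIsometric ι := 𝔹.isometric ι hι

/-- Any two points lie in the image of a chart, which can be chosen to have a prescribed
value at a point of the right type. -/
theorem exists_chart_through (hι : ι ∈ 𝔹.atlas) (u : Sph n) (y : B) :
    ∃ ι' ∈ 𝔹.atlas, ι' u = ι u ∧ ∃ v, ι' v = y := by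
  obtain ⟨ι₃, h₃, ⟨a, ha⟩, b, hb⟩ := 𝔹.plenty (ι u) y
  obtain ⟨w, hw, hwc⟩ := 𝔹.compatible ι₃ h₃ ι hι
  refine ⟨_, 𝔹.precomp ι₃ h₃ w hw, ?_, sphAct w⁻¹ b, ?_⟩
  · rw [← hwc a u ha, ha]
  · rw [← sphAct_mul, mul_inv_cancel, sphAct_one, hb]

/-- Put `ι v` and `ι' v` in one apartment. The coordinate change to `ι'` moves `v` by the distance
of these points, which is at most `2 * sphDist u v` by the triangle inequality through `ι u`. If
such a change must fix `v`, the points coincide. -/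
theorem chart_eq_of_displacement (hι : ι ∈ 𝔹.atlas) (hι' : ι' ∈ 𝔹.atlas) {u v : Sph n}
    (hu : ι u = ι' u) (h : ∀ w ∈ 𝔹.weyl, sphDist v (sphAct w v) ≤ 2 * sphDist u v → sphAct w v = v) :
    ι v = ι' v := by
  obtain ⟨ι₃, h₃, hv, b, hb⟩ := 𝔹.exists_chart_through hι v (ι' v)
  obtain ⟨w, hw, hwc⟩ := 𝔹.compatible ι₃ h₃ ι' hι'
  have hbv := hwc b v hb
  have hle : sphDist v (sphAct w v) ≤ 2 * sphDist u v := by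
    rw [← hbv, ← 𝔹.isometric ι₃ h₃, hv, hb]
    have := dist_triangle_left (ι v) (ι' v) (ι u)
    rw [𝔹.isometric ι hι, hu, 𝔹.isometric ι' hι'] at this
    linarith
  rw [← hb, hbv, h w hw hle, hv]

theorem eventually_chart_eq (u : Sph n) :
    ∀ᶠ v in 𝓝 u, (∀ w ∈ 𝔹.weyl, sphAct w u = u → sphAct w v = v) →
      ∀ ι ∈ 𝔹.atlas, ∀ ι' ∈ 𝔹.atlas, ι u = ι' u → ι v = ι' v := by
  have h := (tendsto_const_nhds.prodMk tendsto_id).eventually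
    (eventually_fixes_of_displacement_le 𝔹.finite_weyl u)
  filter_upwards [h] with v hv hst ι hι ι' hι' huu
  exact 𝔹.chart_eq_of_displacement hι hι' huu fun w hw hle => hst w hw (hv w hw hle)

/-- One neighbourhood serves all base points in it and all pairs of charts; this uniformity is what
lets the centre vary in `exists_lift`. -/
theorem exists_nhds_chart_eq {u : Sph n} (hu : IsRegularPoint 𝔹.weyl u) :
    ∃ U ∈ 𝓝 u, ∀ v ∈ U, ∀ v' ∈ U, ∀ ι ∈ 𝔹.atlas, ∀ ι' ∈ 𝔹.atlas, ι v = ι' v → ι v' = ι' v' := by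
  obtain ⟨U, hU, h⟩ := eventually_prod_self_iff'.1
    (eventually_fixes_of_displacement_le 𝔹.finite_weyl u)
  refine ⟨U, hU, fun v hv v' hv' ι hι ι' hι' hvv => ?_⟩
  refine 𝔹.chart_eq_of_displacement hι hι' hvv fun w hw hle => ?_
  rw [hu w hw (h v hv v' hv' w hw hle), sphAct_one]

theorem eventually_chart_eq_of_isRegularPoint {u : Sph n} (hu : IsRegularPoint 𝔹.weyl u)
    (hι : ι ∈ 𝔹.atlas) (hι' : ι' ∈ 𝔹.atlas) (h : ι u = ι' u) : ∀ᶠ v in 𝓝 u, ι v = ι' v := by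
  filter_upwards [𝔹.eventually_chart_eq u] with v hv
  refine hv (fun w hw hwu => ?_) ι hι ι' hι' h
  rw [hu w hw hwu, sphAct_one]

/-- Charts that agree at the beginning of a path along which stabilizers do not shrink
agree at its end. -/
theorem chart_eq_of_path (hι : ι ∈ 𝔹.atlas) (hι' : ι' ∈ 𝔹.atlas) {γ : ℝ → Sph n}
    (hγ : ContinuousOn γ (Icc 0 1))
    (hst : ∀ t ∈ Ico (0 : ℝ) 1, ∀ s ∈ Ioc t 1, ∀ w ∈ 𝔹.weyl, sphAct w (γ t) = γ t →
      sphAct w (γ s) = γ s)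
    (h0 : ι (γ 0) = ι' (γ 0)) : ι (γ 1) = ι' (γ 1) := by
  have hcl : IsClosed ({t : ℝ | ι (γ t) = ι' (γ t)} ∩ Icc 0 1) := by
    have h1 := (𝔹.sphIsometric hι).short.continuous.comp_continuousOn hγ
    have h2 := (𝔹.sphIsometric hι').short.continuous.comp_continuousOn hγ
    have h3 := (h1.prodMk h2).preimage_isClosed_of_isClosed isClosed_Icc
      (isClosed_diagonal (X := B))
    rw [inter_comm]
    exact h3
  -- The agreement set is closed, and from each of its points before 1 one can advance to the right.
  refine hcl.Icc_subset_of_forall_exists_gt h0 ?_ ⟨zero_le_one, le_rfl⟩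
  rintro t ⟨ht, ht1⟩ y hy
  have hy : t < y := hy
  have hcont : Tendsto γ (𝓝[>] t) (𝓝 (γ t)) := by
    have h1 : Tendsto γ (𝓝[Icc 0 1] t) (𝓝 (γ t)) := hγ t ⟨ht1.1, ht1.2.le⟩
    refine h1.mono_left ?_
    rw [← nhdsWithin_Ioc_eq_nhdsGT ht1.2]
    exact nhdsWithin_mono _ fun s hs => ⟨ht1.1.trans hs.1.le, hs.2⟩
  have hev := hcont.eventually (𝔹.eventually_chart_eq (γ t))
  obtain ⟨s, hs, hs1⟩ := (hev.and (Ioc_mem_nhdsGT (lt_min hy ht1.2))).exists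
  refine ⟨s, ?_, hs1.1, hs1.2.trans (min_le_left _ _)⟩
  exact hs (hst t ht1 s ⟨hs1.1, hs1.2.trans (min_le_right _ _)⟩) ι hι ι' hι' ht

end SphericalBuilding

/-! ### Charts through antipodes. -/

namespace SphericalBuilding

variable {n : ℕ} {B : Type*} [MetricSpace B] (𝔹 : SphericalBuilding n B) {ι ι' : Sph n → B}

/-- A chart through `ι u` and an antipode `y` of `ι u` takes the value `y` at `-u`. -/
theorem exists_chart_antipode (hι : ι ∈ 𝔹.atlas) (u : Sph n) {y : B}
    (hy : Real.pi ≤ dist (ι u) y) : ∃ ι' ∈ 𝔹.atlas, ι' u = ι u ∧ ι' (-u) = y := by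
  obtain ⟨ι', hι', hu, v, rfl⟩ := 𝔹.exists_chart_through hι u y
  refine ⟨ι', hι', hu, ?_⟩
  rw [← hu, 𝔹.isometric ι' hι'] at hy
  rw [eq_neg_of_sphDist_eq_pi (le_antisymm (sphDist_le_pi _ _) hy)]

/-- Follow the segment towards `q`: stabilizers are trivial before the end, so only the endpoint `q`
may be singular. -/
theorem chart_eq_of_regular_segment (hι : ι ∈ 𝔹.atlas) (hι' : ι' ∈ 𝔹.atlas) {q : Sph n}
    {x : EuclideanSpace ℝ (Fin (n + 1))}
    (hx : ∀ s ∈ Ioc (0 : ℝ) 1, (q + s • x : EuclideanSpace ℝ (Fin (n + 1))) ≠ 0 ∧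
      IsRegularPoint 𝔹.weyl (toSph (q + s • x)))
    (h : ι (toSph (q + x)) = ι' (toSph (q + x))) : ι q = ι' q := by
  have key := 𝔹.chart_eq_of_path (γ := fun s => toSph (q + (1 - s) • x)) hι hι' ?_ ?_ ?_
  · simpa [toSph_coe] using key
  · intro s hs
    have hne : (q + (1 - s) • x : EuclideanSpace ℝ (Fin (n + 1))) ≠ 0 := by
      rcases hs.2.eq_or_lt with rfl | h1
      · simpa using q.coe_ne_zero
      · exact (hx (1 - s) ⟨by linarith, by linarith [hs.1]⟩).1
    exact (ContinuousAt.comp (f := fun s : ℝ => (q + (1 - s) • x : EuclideanSpace ℝ (Fin (n + 1))))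
      (continuousAt_toSph hne) (by fun_prop)).continuousWithinAt
  · intro t ht s _ w hw hwt
    rw [(hx (1 - t) ⟨by linarith [ht.2], by linarith [ht.1]⟩).2 w hw hwt, sphAct_one]
  · simpa using h

/-- If `p₁` is an antipode of `ι q`, then some chart extends the germ of `ι` at a nearby regular
point and takes `q`, `-q` to `ι q`, `p₁`. -/
theorem exists_chart_antipode_of_regular_segment (hι : ι ∈ 𝔹.atlas) {q : Sph n}
    {x : EuclideanSpace ℝ (Fin (n + 1))}
    (hx : ∀ s ∈ Ioc (0 : ℝ) 1, (q + s • x : EuclideanSpace ℝ (Fin (n + 1))) ≠ 0 ∧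
      IsRegularPoint 𝔹.weyl (toSph (q + s • x))) {p₁ : B} (hp : Real.pi ≤ dist (ι q) p₁) :
    ∃ ι' ∈ 𝔹.atlas, ι' (toSph (q + x)) = ι (toSph (q + x)) ∧ ι' q = ι q ∧ ι' (-q) = p₁ := by
  obtain ⟨ι', hι', hu, v, rfl⟩ := 𝔹.exists_chart_through hι (toSph (q + x)) p₁
  have hq := 𝔹.chart_eq_of_regular_segment hι' hι hx hu
  refine ⟨ι', hι', hu, hq, ?_⟩
  rw [← hq, 𝔹.isometric ι' hι'] at hp
  rw [eq_neg_of_sphDist_eq_pi (le_antisymm (sphDist_le_pi _ _) hp)]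

end SphericalBuilding

/-! ### Changing a lift so that it passes through a prescribed point. -/

section Lift

variable {n : ℕ} {B₁ B₂ : Type*} [MetricSpace B₁] [MetricSpace B₂]

theorem exists_regular_segments
    {W : Subgroup (EuclideanSpace ℝ (Fin (n + 1)) ≃ₗᵢ[ℝ] EuclideanSpace ℝ (Fin (n + 1)))}
    (hW : Finite W) (q : Sph n) :
    ∃ x : EuclideanSpace ℝ (Fin (n + 1)), angle (q + x) (q - x) < Real.pi ∧
      ∀ s : ℝ, s ≠ 0 → |s| ≤ 1 → (q + s • x : EuclideanSpace ℝ (Fin (n + 1))) ≠ 0 ∧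
        IsRegularPoint W (toSph (q + s • x)) := by
  obtain ⟨e, he⟩ := exists_regular_vector hW
  have h1 := eventually_isRegularPoint_add_smul hW q he
  have h2 := nhdsWithin_le_nhds (s := {0}ᶜ) (eventually_add_smul_ne_zero q e)
  have h3 : ∀ᶠ t : ℝ in 𝓝 0, angle (q + t • e : EuclideanSpace ℝ (Fin (n + 1))) (q - t • e) < Real.pi := by
    have hc : ContinuousAt (fun t : ℝ => angle (q + t • e : EuclideanSpace ℝ (Fin (n + 1)))
        (q - t • e)) 0 :=
      ContinuousAt.comp (f := fun t : ℝ => ((q + t • e : EuclideanSpace ℝ (Fin (n + 1))),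
        (q - t • e : EuclideanSpace ℝ (Fin (n + 1)))))
        (continuousAt_angle (by simpa using q.coe_ne_zero) (by simpa using q.coe_ne_zero))
        (by fun_prop)
    refine hc.eventually_lt continuousAt_const ?_
    simpa [angle_self q.coe_ne_zero] using Real.pi_pos
  obtain ⟨ε, hε, hball⟩ := Metric.mem_nhdsWithin_iff.1 ((h1.and h2).and (nhdsWithin_le_nhds h3))
  have hmem : ∀ t : ℝ, t ≠ 0 → |t| < ε → t ∈ Metric.ball (0 : ℝ) ε ∩ {0}ᶜ := fun t ht hlt =>
    ⟨by simpa using hlt, ht⟩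
  have hε2 : |ε / 2| < ε := by rw [abs_of_pos (by positivity)]; linarith
  refine ⟨(ε / 2) • e, (hball (hmem (ε / 2) (by positivity) hε2)).2, fun s hs hs1 => ?_⟩
  have h := hball (hmem (s * (ε / 2)) (mul_ne_zero hs (by positivity)) ?_)
  · rw [smul_smul]
    exact ⟨h.1.2, h.1.1⟩
  · rw [abs_mul]
    nlinarith [abs_nonneg (ε / 2)]

variable (𝔹₁ : SphericalBuilding n B₁) {f : B₁ → B₂} {κ : Sph n → B₂} {ι ι' : Sph n → B₁}

/-- Mostly used for `v = -u`, where it gives distance at least `π` between preimages of antipodes.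
-/
theorem SphIsometric.le_dist_of_short (hf : LipschitzWith 1 f) (hκ : SphIsometric κ) {x y : B₁}
    {u v : Sph n} (hx : f x = κ u) (hy : f y = κ v) : sphDist u v ≤ dist x y := by
  rw [← hκ, ← hx, ← hy]
  have h1 := hf.dist_le_mul x y
  rwa [NNReal.coe_one, one_mul] at h1

namespace SphericalBuilding

/-- If a chart `ι` lifts `κ`, then any chart `ι'` with the same germ at `-p` which takes `p` to a
lift `p₁` of `κ p` also lifts `κ`. -/
theorem lift_of_eventuallyEq (hX : IsCAT1 B₂) (hf : LipschitzWith 1 f) (hκ : SphIsometric κ)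
    (hι : ι ∈ 𝔹₁.atlas) (hι' : ι' ∈ 𝔹₁.atlas) (hfι : ∀ u, f (ι u) = κ u) {p : Sph n}
    (hfp : f (ι' p) = κ p) (h : ∀ᶠ z in 𝓝 (-p), ι' z = ι z) :
    (∀ u, f (ι' u) = κ u) ∧ ∀ z, dist (ι' p) (ι z) ≤ sphDist p z → ι' z = ι z := by
  refine ⟨fun u => ?_, fun z hz => ?_⟩
  · have hshort := (𝔹₁.sphIsometric hι').short.comp hf
    refine hX.eq_of_eventuallyEq (u := -p) hκ hshort ?_ ?_
    · filter_upwards [h] with z hz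
      rw [hz, hfι]
    · rw [neg_neg, ← hfp]
      exact hshort _ _
  · refine (𝔹₁.cat1.eq_of_eventuallyEq (u := -p) (𝔹₁.sphIsometric hι') (𝔹₁.sphIsometric hι).short
      h ?_).symm
    rwa [neg_neg, dist_comm, sphDist_comm]

/-- It is enough to find a chart with the germ of `ι` at `q = -p` and the value `p₁` at `p`. If `q`
is regular, any chart taking `q`, `-q` to `ι q`, `p₁` will do. Otherwise take regular points `a`,
`b` on opposite sides of `q`. The chart `ι₅` keeps the germ at `a`, and its value at `-a` is chosen
so that it also contains `ι b` and `p₁`; arcs from `b` to points near `a` then recover the germ at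
`q`. -/
theorem exists_lift_through (hX : IsCAT1 B₂) (hf : LipschitzWith 1 f) (hκ : SphIsometric κ)
    (hι : ι ∈ 𝔹₁.atlas) (hfι : ∀ u, f (ι u) = κ u) {p : Sph n} {p₁ : B₁} (hp : f p₁ = κ p) :
    ∃ ι' ∈ 𝔹₁.atlas, (∀ u, f (ι' u) = κ u) ∧ ι' p = p₁ ∧
      ∀ z, dist p₁ (ι z) ≤ sphDist p z → ι' z = ι z := by
  suffices h : ∃ ι' ∈ 𝔹₁.atlas, ι' p = p₁ ∧ ∀ᶠ z in 𝓝 (-p), ι' z = ι z by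
    obtain ⟨ι', hι', rfl, h⟩ := h
    obtain ⟨h1, h2⟩ := 𝔹₁.lift_of_eventuallyEq hX hf hκ hι hι' hfι hp h
    exact ⟨ι', hι', h1, rfl, h2⟩
  obtain ⟨q, rfl⟩ : ∃ q, p = -q := ⟨-p, (neg_neg p).symm⟩
  rw [neg_neg]
  have hqp : Real.pi ≤ dist (ι q) p₁ := by
    have := hκ.le_dist_of_short hf (hfι q) hp
    rwa [sphDist_neg_right, sphDist_self, sub_zero] at this
  by_cases hq : IsRegularPoint 𝔹₁.weyl q
  · obtain ⟨ι', hι', h1, h2⟩ := 𝔹₁.exists_chart_antipode hι q hqp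
    exact ⟨ι', hι', h2, 𝔹₁.eventually_chart_eq_of_isRegularPoint hq hι' hι h1⟩
  obtain ⟨x, hang, hx⟩ := exists_regular_segments 𝔹₁.finite_weyl q
  have hx1 : ∀ s ∈ Ioc (0 : ℝ) 1, (q + s • x : EuclideanSpace ℝ (Fin (n + 1))) ≠ 0 ∧
      IsRegularPoint 𝔹₁.weyl (toSph (q + s • x)) := fun s hs =>
    hx s hs.1.ne' (by rw [abs_of_pos hs.1]; exact hs.2)
  have hx2 : ∀ s ∈ Ioc (0 : ℝ) 1, (q + s • (-x) : EuclideanSpace ℝ (Fin (n + 1))) ≠ 0 ∧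
      IsRegularPoint 𝔹₁.weyl (toSph (q + s • (-x))) := fun s hs => by
    rw [smul_neg, ← neg_smul]
    exact hx (-s) (neg_ne_zero.2 hs.1.ne') (by rw [abs_neg, abs_of_pos hs.1]; exact hs.2)
  have hr1 := hx1 1 ⟨zero_lt_one, le_rfl⟩
  have hr2 := hx2 1 ⟨zero_lt_one, le_rfl⟩
  rw [one_smul] at hr1 hr2
  obtain ⟨ι₃, h₃, h₃a, h₃q, h₃p⟩ := 𝔹₁.exists_chart_antipode_of_regular_segment hι hx1 hqp
  obtain ⟨ι₄, h₄, h₄b, h₄q, h₄p⟩ := 𝔹₁.exists_chart_antipode_of_regular_segment hι hx2 hqp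
  set a := toSph (q + x : EuclideanSpace ℝ (Fin (n + 1))) with ha
  set b := toSph (q + -x : EuclideanSpace ℝ (Fin (n + 1))) with hb
  -- If `b` and `-q` were antipodal, then `b = q`; but `b` is regular and `q` is not.
  have hbq : sphDist b (-q) < Real.pi := by
    refine lt_of_le_of_ne (sphDist_le_pi _ _) fun h => hq ?_
    rw [neg_injective (eq_neg_of_sphDist_eq_pi h)]
    exact hr2.2
  have hab : sphDist b q + sphDist q a = sphDist b a := by
    have h2 : (2 : ℝ) • (q : EuclideanSpace ℝ (Fin (n + 1))) = (q + -x) + (q + x) := by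
      rw [two_smul]; abel
    have h3 := angle_add_angle_of_nonneg (x := (q + -x : EuclideanSpace ℝ (Fin (n + 1))))
      (y := q + x) zero_le_one zero_le_one
      (by rw [one_smul, one_smul, ← h2]; exact smul_ne_zero two_ne_zero q.coe_ne_zero)
    rw [one_smul, one_smul, ← h2, angle_smul_left_of_pos _ _ two_pos,
      angle_smul_right_of_pos _ _ two_pos] at h3
    rw [ha, hb, sphDist_toSph_left hr2.1, sphDist_toSph_right hr1.1, sphDist_toSph hr2.1 hr1.1]
    exact h3
  have hshort4 := (𝔹₁.sphIsometric h₄).short.comp hf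
  -- `-a` lies on the arc from `b` to `-q`, and `f ∘ ι₄` already has the right values at both ends.
  have hfa : f (ι₄ (-a)) = κ (-a) := by
    have e1 : f (ι₄ b) = κ b := by rw [h₄b, hfι]
    have e2 : f (ι₄ (-q)) = κ (-q) := by rw [h₄p, hp]
    refine hX.eq_of_between (x := κ b) (y := κ (-q)) (a := sphDist b (-a))
      (b := sphDist (-a) (-q)) (by rwa [hκ]) ?_ ?_ ?_ (hκ _ _).le (hκ _ _).le
    · rw [hκ, sphDist_neg_right, sphDist_neg_left, sphDist_neg_right, sphDist_neg_right, ← hab,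
        sphDist_comm a q]
      linarith
    · rw [← e1]; exact hshort4 _ _
    · rw [← e2]; exact hshort4 _ _
  obtain ⟨ι₅, h₅, h₅a, h₅a'⟩ := 𝔹₁.exists_chart_antipode hι a (y := ι₄ (-a)) (by
    have := hκ.le_dist_of_short hf (hfι a) hfa
    rwa [sphDist_neg_right, sphDist_self, sub_zero] at this)
  have hnear := 𝔹₁.eventually_chart_eq_of_isRegularPoint hr1.2 h₅ hι h₅a
  have hnear3 := 𝔹₁.eventually_chart_eq_of_isRegularPoint hr1.2 h₅ h₃ (h₅a.trans h₃a.symm)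
  -- `ι₃` and `ι₅` agree near `a`; the remaining distance, from `p₁` to `ι₅ (-a)`, is measured in
  -- `ι₄`, which contains both points. The same works for `b`, with `ι` in place of `ι₃`.
  have h₅p : ι₅ (-q) = p₁ := by
    rw [← h₃p]
    refine (𝔹₁.cat1.eq_of_eventuallyEq (𝔹₁.sphIsometric h₅) (𝔹₁.sphIsometric h₃).short
      hnear3 ?_).symm
    rw [h₅a', h₃p, ← h₄p]
    exact (𝔹₁.isometric ι₄ h₄ _ _).le
  have h₅b : ι₅ b = ι b := by
    refine (𝔹₁.cat1.eq_of_eventuallyEq (𝔹₁.sphIsometric h₅) (𝔹₁.sphIsometric hι).short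
      hnear ?_).symm
    rw [h₅a', ← h₄b]
    exact (𝔹₁.isometric ι₄ h₄ _ _).le
  refine ⟨ι₅, h₅, h₅p, ?_⟩
  -- Chosen so that `y z + (q - x) = 2 • z`: a point `z` near `q` lies on the arc from a direction
  -- near `a` to `b`.
  let y : Sph n → EuclideanSpace ℝ (Fin (n + 1)) := fun z => (2 : ℝ) • (z : EuclideanSpace ℝ (Fin (n + 1))) - (q - x)
  have hy : Continuous y := by fun_prop
  have hyq : y q = q + x := by
    simp only [y, two_smul]; abel
  have hne : ∀ᶠ z in 𝓝 q, y z ≠ 0 := (isOpen_ne.preimage hy).mem_nhds (by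
    rw [mem_preimage, hyq]; exact hr1.1)
  have hyang : ∀ᶠ z in 𝓝 q, angle (y z) (q - x) < Real.pi := by
    have hc : ContinuousAt (fun z => angle (y z) (q - x)) q :=
      ContinuousAt.comp (f := fun z => (y z, (q - x : EuclideanSpace ℝ (Fin (n + 1)))))
        (continuousAt_angle (by rw [hyq]; exact hr1.1) (by rw [sub_eq_add_neg]; exact hr2.1))
        (hy.prodMk continuous_const).continuousAt
    refine hc.eventually_lt continuousAt_const ?_
    rwa [hyq]
  have hynear : ∀ᶠ z in 𝓝 q, ι₅ (toSph (y z)) = ι (toSph (y z)) := by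
    have hc : Tendsto (fun z => toSph (y z)) (𝓝 q) (𝓝 a) := by
      have := (ContinuousAt.comp (f := y) (x := q) (continuousAt_toSph (by rw [hyq]; exact hr1.1))
        hy.continuousAt).tendsto
      rwa [Function.comp_apply, hyq] at this
    exact hc.eventually hnear
  filter_upwards [hne, hyang, hynear] with z hz1 hz2 hz3
  have key := 𝔹₁.cat1.eq_toSph_add (𝔹₁.sphIsometric h₅) (𝔹₁.sphIsometric hι).short hz1
    (y := q - x) (by rw [sub_eq_add_neg]; exact hr2.1) hz2 hz3 (by rw [sub_eq_add_neg]; exact h₅b)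
  rwa [sub_add_cancel, toSph_smul z.coe_ne_zero two_pos, toSph_coe] at key

end SphericalBuilding

end Lift

/-! ### Linear extension of local isometries of the sphere. -/

section Extension

variable {n : ℕ}

theorem span_nhds_sphere {u : Sph n} {U : Set (Sph n)} (hU : U ∈ 𝓝 u) :
    Submodule.span ℝ (Subtype.val '' U : Set (EuclideanSpace ℝ (Fin (n + 1)))) = ⊤ := by
  rw [Submodule.eq_top_iff']
  intro x
  set V := Submodule.span ℝ (Subtype.val '' U : Set (EuclideanSpace ℝ (Fin (n + 1))))
  have hmem : ∀ v ∈ U, (v : EuclideanSpace ℝ (Fin (n + 1))) ∈ V := fun v hv =>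
    Submodule.subset_span ⟨v, hv, rfl⟩
  have h1 : ∀ᶠ t : ℝ in 𝓝[≠] 0, toSph (u + t • x : EuclideanSpace ℝ (Fin (n + 1))) ∈ U ∧
      (u + t • x : EuclideanSpace ℝ (Fin (n + 1))) ≠ 0 := nhdsWithin_le_nhds
    (((tendsto_toSph_add_smul u x).eventually hU).and (eventually_add_smul_ne_zero u x))
  obtain ⟨t, ⟨ht, hne⟩, ht0⟩ := (h1.and self_mem_nhdsWithin).exists
  have h2 := hmem _ ht
  rw [coe_toSph hne, Submodule.smul_mem_iff _ (inv_ne_zero (norm_ne_zero_iff.2 hne)),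
    Submodule.add_mem_iff_right _ (hmem u (mem_of_mem_nhds hU)), Submodule.smul_mem_iff _ ht0] at h2
  exact h2

theorem inner_eq_cos_sphDist (u v : Sph n) :
    inner ℝ (u : EuclideanSpace ℝ (Fin (n + 1))) v = Real.cos (sphDist u v) :=
  inner_eq_cos_angle_of_norm_eq_one (norm_eq_of_mem_sphere u) (norm_eq_of_mem_sphere v)

/-- A distance-preserving map from an open subset of the sphere to the sphere is the restriction
of a linear isometry. -/
theorem exists_linearIsometryEquiv_of_nhds {u : Sph n} {U : Set (Sph n)} (hU : U ∈ 𝓝 u)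
    {θ : Sph n → Sph n} (h : ∀ v ∈ U, ∀ v' ∈ U, sphDist (θ v) (θ v') = sphDist v v') :
    ∃ G : EuclideanSpace ℝ (Fin (n + 1)) ≃ₗᵢ[ℝ] EuclideanSpace ℝ (Fin (n + 1)),
      ∀ v ∈ U, θ v = sphAct G v := by
  let b := Module.Basis.ofSpan (span_nhds_sphere hU).ge
  have hb : ∀ i, ∃ c ∈ U, (c : EuclideanSpace ℝ (Fin (n + 1))) = b i := fun i =>
    Module.Basis.ofSpan_subset (span_nhds_sphere hU).ge ⟨i, rfl⟩
  choose c hcU hc using hb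
  let L := b.constr ℝ fun i => (θ (c i) : EuclideanSpace ℝ (Fin (n + 1)))
  have hLb : ∀ i, L (b i) = θ (c i) := fun i => b.constr_basis ℝ _ i
  have hθ : ∀ v ∈ U, ∀ v' ∈ U, inner ℝ (θ v : EuclideanSpace ℝ (Fin (n + 1))) (θ v') =
      inner ℝ (v : EuclideanSpace ℝ (Fin (n + 1))) v' := fun v hv v' hv' => by
    rw [inner_eq_cos_sphDist, inner_eq_cos_sphDist, h v hv v' hv']
  have hL : (innerₗ (EuclideanSpace ℝ (Fin (n + 1)))).compl₁₂ L L =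
      innerₗ (EuclideanSpace ℝ (Fin (n + 1))) := by
    refine LinearMap.ext_basis b b fun i j => ?_
    rw [LinearMap.compl₁₂_apply, innerₗ_apply_apply, innerₗ_apply_apply, hLb, hLb,
      hθ _ (hcU i) _ (hcU j), hc, hc]
  have hL' : ∀ x y, inner ℝ (L x) (L y) = inner ℝ x y := fun x y => by
    have := LinearMap.congr_fun₂ hL x y
    rwa [LinearMap.compl₁₂_apply, innerₗ_apply_apply, innerₗ_apply_apply] at this
  let G := (L.isometryOfInner hL').toLinearIsometryEquiv rfl
  have hG : ∀ x, G x = L x := fun x => rfl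
  refine ⟨G, fun v hv => Subtype.ext ?_⟩
  -- Both sides can be tested by inner products against the basis `b`, which consists of points of
  -- `U`.
  suffices hs : G.symm (θ v : EuclideanSpace ℝ (Fin (n + 1))) = v by
    exact (G.apply_symm_apply _).symm.trans (congrArg G hs)
  refine InnerProductSpace.ext_inner_left_basis b fun i => ?_
  rw [← G.inner_map_map, G.apply_symm_apply, hG, hLb, hθ _ (hcU i) _ hv, hc]

end Extension

/-! ### Existence of one lift. -/

namespace SphericalBuilding

variable {n : ℕ} {B₁ B₂ : Type*} [MetricSpace B₁] [MetricSpace B₂]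
  (𝔹₁ : SphericalBuilding n B₁) (𝔹₂ : SphericalBuilding n B₂) {f : B₁ → B₂} {κ : Sph n → B₂}

/-- A geodesic between antipodes in an apartment stays in the apartment if it starts at a
regular point. -/
theorem mem_range_of_isRegularPoint (hκ : κ ∈ 𝔹₂.atlas) {u : Sph n}
    (hu : IsRegularPoint 𝔹₂.weyl u) {z : B₂}
    (hz : dist (κ u) z + dist z (κ (-u)) ≤ Real.pi) : ∃ v, κ v = z := by
  obtain ⟨κ', hκ', huu, v, rfl⟩ := 𝔹₂.exists_chart_through hκ u z
  refine ⟨v, (𝔹₂.cat1.eq_of_eventuallyEq (𝔹₂.sphIsometric hκ) (𝔹₂.sphIsometric hκ').short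
    (𝔹₂.eventually_chart_eq_of_isRegularPoint hu hκ hκ' huu.symm) ?_).symm⟩
  rw [← huu, 𝔹₂.isometric κ' hκ'] at hz
  rw [sphDist_neg_right, sphDist_comm]
  linarith

/-- Join `ι a` to a preimage of `κ (-u)`. Shortness places each image point on a geodesic from `κ u`
to `κ (-u)`; it starts at a regular point, so it stays in the apartment, and the two distance bounds
must be equalities. -/
theorem exists_chart_mapsTo_apartment (hf : LipschitzWith 1 f) (hsurj : Function.Surjective f)
    (hκ : κ ∈ 𝔹₂.atlas) {u : Sph n} (hu : IsRegularPoint 𝔹₂.weyl u) {ι : Sph n → B₁}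
    (hι : ι ∈ 𝔹₁.atlas) {a : Sph n} (ha : f (ι a) = κ u) :
    ∃ ι' ∈ 𝔹₁.atlas, ι' a = ι a ∧ f (ι' (-a)) = κ (-u) ∧
      ∀ v, ∃ v', κ v' = f (ι' v) ∧ sphDist u v' = sphDist a v := by
  have hκ' := 𝔹₂.sphIsometric hκ
  obtain ⟨y, hy⟩ := hsurj (κ (-u))
  obtain ⟨ι', hι', haa, hay⟩ := 𝔹₁.exists_chart_antipode hι a (y := y) (by
    have := hκ'.le_dist_of_short hf ha hy
    rwa [sphDist_neg_right, sphDist_self, sub_zero] at this)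
  have hshort := (𝔹₁.sphIsometric hι').short.comp hf
  refine ⟨ι', hι', haa, by rw [hay, hy], fun v => ?_⟩
  have h1 : dist (κ u) (f (ι' v)) ≤ sphDist a v := by
    rw [← ha, ← haa]
    exact hshort a v
  have h2 : dist (f (ι' v)) (κ (-u)) ≤ Real.pi - sphDist a v := by
    rw [← hy, ← hay, sphDist_comm, ← sphDist_neg_right]
    exact hshort v (-a)
  obtain ⟨v', hv'⟩ := 𝔹₂.mem_range_of_isRegularPoint hκ hu (z := f (ι' v)) (by linarith)
  refine ⟨v', hv', ?_⟩
  rw [← hv', hκ'] at h1 h2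
  rw [sphDist_neg_right, sphDist_comm] at h2
  linarith

/-- Each apartment is the isometric image of some apartment. -/
theorem exists_lift (hf : LipschitzWith 1 f) (hsurj : Function.Surjective f) (hκ : κ ∈ 𝔹₂.atlas) :
    ∃ ι ∈ 𝔹₁.atlas, ∃ G : EuclideanSpace ℝ (Fin (n + 1)) ≃ₗᵢ[ℝ] EuclideanSpace ℝ (Fin (n + 1)),
      ∀ v, f (ι v) = κ (sphAct G v) := by
  have hκ' := 𝔹₂.sphIsometric hκ
  obtain ⟨u₀, hu₀⟩ := (frequently_isRegularPoint 𝔹₂.finite_weyl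
    (⟨EuclideanSpace.single 0 1, by simp⟩ : Sph n)).exists
  obtain ⟨x, hx⟩ := hsurj (κ u₀)
  obtain ⟨ι₀, hι₀, ⟨a, ha⟩, -⟩ := 𝔹₁.plenty x x
  rw [← ha] at hx
  obtain ⟨ι, hι, haa, -, hθ⟩ := 𝔹₁.exists_chart_mapsTo_apartment 𝔹₂ hf hsurj hκ hu₀ hι₀ hx
  choose θ hθ hθd using hθ
  -- Although `θ` comes from choice, it inherits continuity at `a` from `f ∘ ι`, as `κ` is a closed
  -- embedding.
  have hlim : Tendsto θ (𝓝 a) (𝓝 u₀) := by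
    have h1 : Tendsto (fun v => κ (θ v)) (𝓝 a) (𝓝 (κ u₀)) := by
      have h2 : Continuous fun v => f (ι v) := ((𝔹₁.sphIsometric hι).short.comp hf).continuous
      have h3 := h2.tendsto a
      rw [haa, hx] at h3
      simpa only [hθ] using h3
    have h2 : Topology.IsClosedEmbedding κ :=
      hκ'.short.continuous.isClosedEmbedding hκ'.injective
    exact (h2.isInducing.tendsto_nhds_iff).2 h1
  have hreg := (hlim.eventually (hu₀.eventually 𝔹₂.finite_weyl)).eventually_nhds
  obtain ⟨u₁, hu₁, hu₁'⟩ := ((frequently_isRegularPoint 𝔹₁.finite_weyl a).and_eventually hreg).exists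
  obtain ⟨U, hU, hUc⟩ := 𝔹₁.exists_nhds_chart_eq hu₁
  have hV := inter_mem hU hu₁'
  set V := U ∩ {v | IsRegularPoint 𝔹₂.weyl (θ v)}
  -- Recentre at `v`: the new chart agrees with `ι` on all of `V`, so the distances it preserves
  -- from `v` are those of the same `θ`.
  have hrec : ∀ v ∈ V, ∃ ι' ∈ 𝔹₁.atlas, f (ι' (-v)) = κ (-θ v) ∧ (∀ z ∈ V, ι' z = ι z) ∧
      ∀ z ∈ V, sphDist (θ v) (θ z) = sphDist v z := by
    intro v hv
    obtain ⟨ι', hι', h1, h2, h3⟩ :=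
      𝔹₁.exists_chart_mapsTo_apartment 𝔹₂ hf hsurj hκ hv.2 hι (hθ v).symm
    have h4 : ∀ z ∈ V, ι' z = ι z := fun z hz => hUc v hv.1 z hz.1 ι' hι' ι hι h1
    refine ⟨ι', hι', h2, h4, fun z hz => ?_⟩
    obtain ⟨z', hz', hd⟩ := h3 z
    rw [h4 z hz, ← hθ] at hz'
    rwa [hκ'.injective hz'] at hd
  obtain ⟨G, hG⟩ := exists_linearIsometryEquiv_of_nhds hV fun v hv v' hv' =>
    (hrec v hv).choose_spec.2.2.2 v' hv'
  obtain ⟨ι₁, hι₁, h1, h2, -⟩ := hrec u₁ (mem_of_mem_nhds hV)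
  have hshort := (𝔹₁.sphIsometric hι₁).short.comp hf
  refine ⟨ι₁, hι₁, G, fun v => ?_⟩
  refine 𝔹₂.cat1.eq_of_eventuallyEq (u := u₁) (hκ'.comp_sphAct G) hshort ?_ ?_
  · filter_upwards [hV] with z hz
    rw [h2 z hz, ← hθ, hG z hz]
  · rw [sphAct_neg, ← hG u₁ (mem_of_mem_nhds hV), ← h1]
    exact hshort v (-u₁)

end SphericalBuilding

/-! ### A finite cell decomposition of the sphere adapted to the group. -/

section SignCell

variable {n : ℕ}

/-- The signs of the coordinates of a vector and of its displacements under a group. -/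
noncomputable def signVector
    (W : Subgroup (EuclideanSpace ℝ (Fin (n + 1)) ≃ₗᵢ[ℝ] EuclideanSpace ℝ (Fin (n + 1))))
    (x : EuclideanSpace ℝ (Fin (n + 1))) : (Fin (n + 1) → SignType) × (W → Fin (n + 1) → SignType) :=
  (fun i => SignType.sign (x i), fun w i => SignType.sign (w.1 x i - x i))

theorem sign_convex_comb {a b t : ℝ} (h : SignType.sign a = SignType.sign b) (ht0 : 0 ≤ t)
    (ht1 : t ≤ 1) : SignType.sign ((1 - t) * a + t * b) = SignType.sign a := by
  rcases lt_trichotomy a 0 with ha | rfl | ha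
  · rw [sign_neg ha] at h ⊢
    have hb := sign_eq_neg_one_iff.1 h.symm
    refine sign_neg ?_
    rcases ht0.eq_or_lt with rfl | h0
    · simpa using ha
    · nlinarith
  · rw [sign_zero] at h
    rw [sign_eq_zero_iff.1 h.symm]
    simp
  · rw [sign_pos ha] at h ⊢
    have hb := sign_eq_one_iff.1 h.symm
    refine sign_pos ?_
    rcases ht0.eq_or_lt with rfl | h0
    · simpa using ha
    · nlinarith

variable {W : Subgroup (EuclideanSpace ℝ (Fin (n + 1)) ≃ₗᵢ[ℝ] EuclideanSpace ℝ (Fin (n + 1)))}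

theorem signVector_convex_comb {x y : EuclideanSpace ℝ (Fin (n + 1))}
    (h : signVector W x = signVector W y) {t : ℝ} (ht0 : 0 ≤ t) (ht1 : t ≤ 1) :
    signVector W ((1 - t) • x + t • y) = signVector W x := by
  refine Prod.ext (funext fun i => ?_) (funext fun w => funext fun i => ?_)
  · have hi := congrFun (congrArg Prod.fst h) i
    exact sign_convex_comb hi ht0 ht1
  · have hi := congrFun (congrFun (congrArg Prod.snd h) w) i
    have := sign_convex_comb hi ht0 ht1
    simp only [signVector] at this ⊢
    rw [← this]
    congr 1
    simp only [map_add, map_smul, PiLp.add_apply, PiLp.smul_apply, smul_eq_mul]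
    ring

theorem fixes_of_signVector_eq {x y : EuclideanSpace ℝ (Fin (n + 1))}
    (h : signVector W x = signVector W y)
    {w : EuclideanSpace ℝ (Fin (n + 1)) ≃ₗᵢ[ℝ] EuclideanSpace ℝ (Fin (n + 1))} (hw : w ∈ W)
    (hx : w x = x) : w y = y := by
  ext i
  have hi : SignType.sign (w x i - x i) = SignType.sign (w y i - y i) :=
    congrFun (congrFun (congrArg Prod.snd h) ⟨w, hw⟩) i
  rw [hx, sub_self, sign_zero] at hi
  exact sub_eq_zero.1 (sign_eq_zero_iff.1 hi.symm)

theorem ne_zero_of_signVector_eq {x y : EuclideanSpace ℝ (Fin (n + 1))}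
    (h : signVector W x = signVector W y) (hx : x ≠ 0) : y ≠ 0 := by
  rintro rfl
  refine hx (PiLp.ext fun i => ?_)
  have hi : SignType.sign (x i) = SignType.sign (0 : ℝ) := congrFun (congrArg Prod.fst h) i
  rw [sign_zero] at hi
  exact sign_eq_zero_iff.1 hi

/-- Equal coordinate signs keep the segment from `u` to `v` away from 0, and equal displacement
signs make stabilizers constant along it, so `chart_eq_of_path` applies. -/
theorem SphericalBuilding.chart_eq_of_signVector_eq {B : Type*} [MetricSpace B]
    (𝔹 : SphericalBuilding n B) {ι ι' : Sph n → B} (hι : ι ∈ 𝔹.atlas) (hι' : ι' ∈ 𝔹.atlas)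
    {u v : Sph n} (h : signVector 𝔹.weyl (u : EuclideanSpace ℝ (Fin (n + 1))) = signVector 𝔹.weyl v)
    (huv : ι u = ι' u) : ι v = ι' v := by
  have hs : ∀ t ∈ Icc (0 : ℝ) 1, signVector 𝔹.weyl
      ((1 - t) • (u : EuclideanSpace ℝ (Fin (n + 1))) + t • v) = signVector 𝔹.weyl u :=
    fun t ht => signVector_convex_comb h ht.1 ht.2
  have hne : ∀ t ∈ Icc (0 : ℝ) 1, ((1 - t) • (u : EuclideanSpace ℝ (Fin (n + 1))) + t • v) ≠ 0 :=
    fun t ht => ne_zero_of_signVector_eq (hs t ht).symm u.coe_ne_zero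
  have key := 𝔹.chart_eq_of_path
    (γ := fun t => toSph ((1 - t) • (u : EuclideanSpace ℝ (Fin (n + 1))) + t • v)) hι hι' ?_ ?_ ?_
  · simpa [toSph_coe] using key
  · intro t ht
    exact (ContinuousAt.comp
      (f := fun t : ℝ => ((1 - t) • (u : EuclideanSpace ℝ (Fin (n + 1))) + t • v))
      (continuousAt_toSph (hne t ht)) (by fun_prop)).continuousWithinAt
  · intro t ht s hst w hw hwt
    have ht' : t ∈ Icc (0 : ℝ) 1 := ⟨ht.1, ht.2.le⟩
    have hs' : s ∈ Icc (0 : ℝ) 1 := ⟨ht.1.trans hst.1.le, hst.2⟩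
    rw [sphAct_toSph_eq_iff (hne t ht')] at hwt
    rw [sphAct_toSph_eq_iff (hne s hs')]
    exact fixes_of_signVector_eq ((hs t ht').trans (hs s hs').symm) hw hwt
  · simpa [toSph_coe] using huv

end SignCell

/-! ### Lifts extending a partial isometric lift. -/

namespace SphericalBuilding

variable {n : ℕ} {B₁ B₂ : Type*} [MetricSpace B₁] [MetricSpace B₂]
  (𝔹₁ : SphericalBuilding n B₁) {f : B₁ → B₂} {κ : Sph n → B₂} {ι : Sph n → B₁}

/-- A partial isometric lift `c` of `κ`, defined on `T`, agrees on any finite set with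
a chart that lifts `κ`. -/
theorem exists_lift_eqOn_finset (hX : IsCAT1 B₂) (hf : LipschitzWith 1 f) (hκ : SphIsometric κ)
    (hι : ι ∈ 𝔹₁.atlas) (hfι : ∀ u, f (ι u) = κ u) {T : Set (Sph n)} {c : Sph n → B₁}
    (hc : ∀ u ∈ T, f (c u) = κ u) (hcd : ∀ u ∈ T, ∀ v ∈ T, dist (c u) (c v) = sphDist u v)
    (F : Finset (Sph n)) (hF : ↑F ⊆ T) :
    ∃ ι' ∈ 𝔹₁.atlas, (∀ u, f (ι' u) = κ u) ∧ ∀ u ∈ F, ι' u = c u := by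
  classical
  induction F using Finset.induction_on with
  | empty => exact ⟨ι, hι, hfι, by simp⟩
  | insert p F _ ih =>
    rw [Finset.coe_insert, insert_subset_iff] at hF
    obtain ⟨ι', hι', h1, h2⟩ := ih hF.2
    obtain ⟨ι'', hι'', h3, h4, h5⟩ := 𝔹₁.exists_lift_through hX hf hκ hι' h1 (hc p hF.1)
    refine ⟨ι'', hι'', h3, fun u hu => ?_⟩
    rcases Finset.mem_insert.1 hu with rfl | hu
    · exact h4
    -- Points absorbed earlier survive because `c` preserves their distances to `p`.
    · rw [h5 u (by rw [h2 u hu, hcd p hF.1 u (hF.2 hu)]), h2 u hu]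

theorem exists_lift_eqOn (hX : IsCAT1 B₂) (hf : LipschitzWith 1 f) (hκ : SphIsometric κ)
    (hι : ι ∈ 𝔹₁.atlas) (hfι : ∀ u, f (ι u) = κ u) {T : Set (Sph n)} {c : Sph n → B₁}
    (hc : ∀ u ∈ T, f (c u) = κ u) (hcd : ∀ u ∈ T, ∀ v ∈ T, dist (c u) (c v) = sphDist u v) :
    ∃ ι' ∈ 𝔹₁.atlas, (∀ u, f (ι' u) = κ u) ∧ ∀ u ∈ T, ι' u = c u := by
  classical
  have := 𝔹₁.finite_weyl
  -- `F` has one point of `T` for each sign vector that occurs. A lift matching `c` on `F` is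
  -- compared, at each `p`, with a lift matching `c` on `F` and at `p`.
  obtain ⟨F, hFT, hFsgn⟩ := exists_subset_bijOn T fun u : Sph n => signVector 𝔹₁.weyl
    (u : EuclideanSpace ℝ (Fin (n + 1)))
  have hFfin : F.Finite := hFsgn.finite_iff_finite.2 (toFinite _)
  have key : ∀ p ∈ T, ∃ ι' ∈ 𝔹₁.atlas, (∀ u, f (ι' u) = κ u) ∧ (∀ u ∈ F, ι' u = c u) ∧
      ι' p = c p := by
    intro p hp
    obtain ⟨ι', hι', h1, h2⟩ := 𝔹₁.exists_lift_eqOn_finset hX hf hκ hι hfι hc hcd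
      (insert p hFfin.toFinset) (by
        rw [Finset.coe_insert, hFfin.coe_toFinset]
        exact insert_subset hp hFT)
    exact ⟨ι', hι', h1, fun u hu => h2 u (Finset.mem_insert_of_mem (hFfin.mem_toFinset.2 hu)),
      h2 p (Finset.mem_insert_self _ _)⟩
  obtain ⟨ι', hι', h1, h2⟩ := 𝔹₁.exists_lift_eqOn_finset hX hf hκ hι hfι hc hcd
    hFfin.toFinset (by rwa [hFfin.coe_toFinset])
  refine ⟨ι', hι', h1, fun p hp => ?_⟩
  obtain ⟨ι'', hι'', -, h4, h5⟩ := key p hp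
  obtain ⟨u, hu, hup⟩ := hFsgn.surjOn ⟨p, hp, rfl⟩
  rw [← h5]
  refine 𝔹₁.chart_eq_of_signVector_eq hι' hι'' hup ?_
  rw [h2 u (hFfin.mem_toFinset.2 hu), h4 u hu]

end SphericalBuilding

/-! ### The theorem. -/

theorem proposition3p3 {n : ℕ} {B₁ B₂ : Type*} [MetricSpace B₁] [MetricSpace B₂]
    (𝔹₁ : SphericalBuilding n B₁) (𝔹₂ : SphericalBuilding n B₂)
    (f : B₁ → B₂) (hf : LipschitzWith 1 f) (hsurj : Function.Surjective f)
    (C₁ : Set B₁) (C₂ : Set B₂) (hconv : IsPiConvex C₁) (hsph : IsSphericalSet C₁)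
    (hC : MapsIsometricallyOnto f C₁ C₂)
    (A₂ : Set B₂) (hA₂ : 𝔹₂.IsApartment A₂) (hCA : C₂ ⊆ A₂) :
    ∃ A₁ : Set B₁, 𝔹₁.IsApartment A₁ ∧ C₁ ⊆ A₁ ∧ MapsIsometricallyOnto f A₁ A₂ := by
  classical
  obtain ⟨κ₀, hκ₀, rfl⟩ := hA₂
  obtain ⟨ι, hι, G, hG⟩ := 𝔹₁.exists_lift 𝔹₂ hf hsurj hκ₀
  obtain ⟨hCd, rfl⟩ := hC
  let κ : Sph n → B₂ := fun u => κ₀ (sphAct G u)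
  have hκ : SphIsometric κ := (𝔹₂.sphIsometric hκ₀).comp_sphAct G
  have hrange : range κ = range κ₀ := by
    refine (range_comp_subset_range (sphAct G) κ₀).antisymm ?_
    rintro _ ⟨u, rfl⟩
    refine ⟨sphAct G⁻¹ u, ?_⟩
    change κ₀ (sphAct G (sphAct G⁻¹ u)) = κ₀ u
    rw [← sphAct_mul, mul_inv_cancel, sphAct_one]
  have hex : ∀ u : Sph n, ∃ x : B₁, κ u ∈ f '' C₁ → x ∈ C₁ ∧ f x = κ u := by
    intro u
    by_cases hu : κ u ∈ f '' C₁
    · obtain ⟨x, hx, hxu⟩ := hu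
      exact ⟨x, fun _ => ⟨hx, hxu⟩⟩
    -- Junk value: only points `u` with `κ u ∈ f '' C₁` matter.
    · exact ⟨ι u, fun h => absurd h hu⟩
  choose c hc using hex
  obtain ⟨ι', hι', h1, h2⟩ := 𝔹₁.exists_lift_eqOn 𝔹₂.cat1 hf hκ hι hG (T := κ ⁻¹' (f '' C₁))
    (fun u hu => (hc u hu).2) fun u hu v hv => by
      rw [← hCd _ (hc u hu).1 _ (hc v hv).1, (hc u hu).2, (hc v hv).2, hκ]
  refine ⟨range ι', ⟨ι', hι', rfl⟩, fun x hx => ?_, ?_, ?_⟩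
  · obtain ⟨u, hu⟩ : f x ∈ range κ := hrange ▸ hCA ⟨x, hx, rfl⟩
    have huC : κ u ∈ f '' C₁ := ⟨x, hx, hu.symm⟩
    refine ⟨u, ?_⟩
    rw [h2 u huC]
    refine dist_le_zero.1 ?_
    rw [← hCd _ (hc u huC).1 x hx, (hc u huC).2, hu, dist_self]
  · rintro _ ⟨u, rfl⟩ _ ⟨v, rfl⟩
    rw [h1, h1, hκ, 𝔹₁.isometric ι' hι']
  · rw [← hrange, ← range_comp]
    exact congrArg range (funext h1)
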